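/- All vector spaces are over $\mathbb{C}$, and $\Gamma$ is a group. For a vector space $W$, put $\mathcal{E}(W)=\mathrm{Hom}(W,W((x)))$. A *vertex algebra* is a vector space $V$ with a vector $\mathbf{1}\in V$ and a linear map $Y(\cdot,x):V\to\mathcal{E}(V)$, $Y(u,x)=\sum_{n\in\mathbb{Z}}u_nx^{-n-1}$, such that $Y(\mathbf 1,x)=1$, $Y(v,x)\mathbf 1\in V[[x]]$ has constant term $v$ for all $v\in V$, and the Jacobi identity holds. A subspace $I$ is an *ideal* if $u_na\in I$ and $a_nu\in I$ for all $a\in I$, $u\in V$, $n\in\mathbb{Z}$. A *$\Gamma$-vertex algebra* is a vertex algebra $V$ with group homomorphisms $R:\Gamma\to \mathrm{GL}(V)$, $g\mapsto R_g$, and $\phi:\Gamma\to\mathbb{C}^\times$ such that $R_g\mathbf 1=\mathbf 1$ and $R_gY(v,x)R_g^{-1}=Y(R_gv,\phi(g)^{-1}x)$ for all $g\in\Gamma$, $v\in V$. A *quasimodule* for a $\Gamma$-vertex algebra $V$ is a vector space $W$ with a linear map $Y_W(\cdot,x):V\to\mathcal{E}(W)$ such that * $Y_W(\mathbf 1,x)=1_W$;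 * for all $u,v\in V$ there is a nonzero polynomial $p(x_1,x_2)$ with $$\begin{aligned}&x_0^{-1}\delta\!\left(\tfrac{x_1-x_2}{x_0}\right)p(x_1,x_2)Y_W(u,x_1)Y_W(v,x_2)-x_0^{-1}\delta\!\left(\tfrac{x_2-x_1}{-x_0}\right)p(x_1,x_2)Y_W(v,x_2)Y_W(u,x_1)\\&\quad=x_2^{-1}\delta\!\left(\tfrac{x_1-x_0}{x_2}\right)p(x_1,x_2)Y_W(Y(u,x_0)v,x_2);\end{aligned}$$ * $Y_W(R_gv,x)=Y_W(v,\phi(g)x)$ for all $g\in\Gamma$, $v\in V$; * for all $u,v\in V$ there are $k\ge 0$ and $\alpha_1,\dots,\alpha_k\in\phi(\Gamma)$ with $(x_1-\alpha_1x_2)\cdots(x_1-\alpha_kx_2)[Y_W(u,x_1),Y_W(v,x_2)]=0$. **Proposition 2.12.** Let $V$ be a $\Gamma$-vertex algebra, let $J$ be the ideal of $V$ generated by the elements $R_hv-v$ for $h\in\ker\phi$, $v\in V$, and let $\overline V=V/J$ be the quotient vertex algebra. Then: 1. $R_g(J)\subset J$ for all $g\in\Gamma$, so that $\Gamma$ acts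 on $\overline V$, and $\ker\phi$ acts trivially on $\overline V$. 2. There is a unique structure of a $\Gamma/\ker\phi$-vertex algebra on $\overline V$, with homomorphisms $\overline R$ and $\overline\phi$, such that the projection $V\to\overline V$ is a homomorphism of vertex algebras, $\overline R_{g\ker\phi}(v+J)=R_gv+J$ and $\overline\phi(g\ker\phi)=\phi(g)$ for all $g\in\Gamma$, $v\in V$. The homomorphism $\overline\phi:\Gamma/\ker\phi\to\mathbb{C}^\times$ is injective. 3. For every $V$-quasimodule $(W,Y_W)$ we have $Y_W(a,x)=0$ for all $a\in J$, and there is a unique quasimodule structure $\overline Y_W$ on $W$ for the $\Gamma/\ker\phi$-vertex algebra $\overline V$ with $\overline Y_W(v+J,x)=Y_W(v,x)$ for all $v\in V$. -/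

import Mathlib

noncomputable section

/-- The substitution `x ↦ α x` in a vertex operator `A(x) ∈ Hom(W, W((x)))`: the coefficient of
`x ^ n` is multiplied by `α ^ n`. -/
def VertexOperator.rescale {W : Type*} [AddCommGroup W] [Module ℂ W] (α : ℂˣ)
    (A : VertexOperator ℂ W) : VertexOperator ℂ W :=
  HVertexOperator.of_coeff (fun n : ℤ => ((α ^ n : ℂˣ) : ℂ) • HVertexOperator.coeff A n)
    (fun w => (HVertexOperator.coeff_isPWOsupport A w).mono (by
      intro n hn h0
      apply hn
      have h1 : HVertexOperator.coeff A n w = 0 := h0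
      change ((α ^ n : ℂˣ) : ℂ) • HVertexOperator.coeff A n w = 0
      rw [h1, smul_zero]))

/-- The vertex operator `A(x) = 1_W`, constant in `x`. -/
def VertexOperator.IsOne {W : Type*} [AddCommGroup W] [Module ℂ W]
    (A : VertexOperator ℂ W) : Prop :=
  ∀ w : W, A w = HahnModule.of ℂ (HahnSeries.single (0 : ℤ) w)

/-! In this block `Y(u, x) v = ∑ u_n v x^{-n-1}` is a product on `V` and `YW(u, x)` is an action
of the elements of `V` by vertex operators on `W`. A formal series in `x₁, x₂` is given by the
family `F m n` of its coefficients at `x₁^{-m-1} x₂^{-n-1}`, a formal series in `x₀, x₁, x₂` by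
the family of its coefficients at `x₀^{-l-1} x₁^{-m-1} x₂^{-n-1}`. -/

namespace FormalJacobi

variable {V W : Type*} [AddCommGroup V] [Module ℂ V] [AddCommGroup W] [Module ℂ W]

/-- The product `p(x₁, x₂) F(x₁, x₂)`, where the variable `0` of `p` is `x₁` and the variable `1`
is `x₂`; the result is again given by its coefficients at `x₁^{-m-1} x₂^{-n-1}`. -/
def polyMul (p : MvPolynomial (Fin 2) ℂ) (F : ℤ → ℤ → W) (m n : ℤ) : W :=
  ∑ d ∈ p.support, p.coeff d • F (m + (d 0 : ℤ)) (n + (d 1 : ℤ))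

/-- The coefficient of `x₀^{-l-1} x₁^{-m-1} x₂^{-n-1}` in
`x₀⁻¹ δ((x₁ - x₂) / x₀) YW(u, x₁) YW(v, x₂) w`, where
`x₀⁻¹ δ((x₁ - x₂) / x₀) = ∑_l x₀^{-l-1} (x₁ - x₂)^l` and `(x₁ - x₂)^l` is expanded in nonnegative
powers of `x₂`. -/
def termLeft (YW : V →ₗ[ℂ] VertexOperator ℂ W) (u v : V) (w : W) (l m n : ℤ) : W :=
  ∑ᶠ i : ℕ, ((-1 : ℂ) ^ i * ((Ring.choose l i : ℤ) : ℂ)) •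
    VertexOperator.ncoeff (YW u) (m + l - i) (VertexOperator.ncoeff (YW v) (n + i) w)

/-- The coefficient of `x₀^{-l-1} x₁^{-m-1} x₂^{-n-1}` in
`x₀⁻¹ δ((x₂ - x₁) / (-x₀)) YW(v, x₂) YW(u, x₁) w`, where
`x₀⁻¹ δ((x₂ - x₁) / (-x₀)) = ∑_l (-1)^l x₀^{-l-1} (x₂ - x₁)^l` and `(x₂ - x₁)^l` is expanded in
nonnegative powers of `x₁`. -/
def termRight (YW : V →ₗ[ℂ] VertexOperator ℂ W) (u v : V) (w : W) (l m n : ℤ) : W :=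
  ∑ᶠ i : ℕ, ((-1 : ℂ) ^ l * (-1 : ℂ) ^ i * ((Ring.choose l i : ℤ) : ℂ)) •
    VertexOperator.ncoeff (YW v) (n + l - i) (VertexOperator.ncoeff (YW u) (m + i) w)

/-- The coefficient of `x₀^{-l-1} x₁^{-m-1} x₂^{-n-1}` in
`x₂⁻¹ δ((x₁ - x₀) / x₂) YW(Y(u, x₀) v, x₂) w`, where
`x₂⁻¹ δ((x₁ - x₀) / x₂) = x₁⁻¹ δ((x₂ + x₀) / x₁) = ∑_m x₁^{-m-1} (x₂ + x₀)^m` and `(x₂ + x₀)^m` is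
expanded in nonnegative powers of `x₀`. -/
def termIterate (Y : V →ₗ[ℂ] VertexOperator ℂ V) (YW : V →ₗ[ℂ] VertexOperator ℂ W)
    (u v : V) (w : W) (l m n : ℤ) : W :=
  ∑ᶠ i : ℕ, ((Ring.choose m i : ℤ) : ℂ) •
    VertexOperator.ncoeff (YW (VertexOperator.ncoeff (Y u) (l + i) v)) (m + n - i) w

/-- The Jacobi identity for the pair `u, v`, multiplied by the polynomial `p(x₁, x₂)`. -/
def HoldsWith (Y : V →ₗ[ℂ] VertexOperator ℂ V) (YW : V →ₗ[ℂ] VertexOperator ℂ W)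
    (p : MvPolynomial (Fin 2) ℂ) (u v : V) : Prop :=
  ∀ (w : W) (l m n : ℤ),
    polyMul p (termLeft YW u v w l) m n - polyMul p (termRight YW u v w l) m n
      = polyMul p (termIterate Y YW u v w l) m n

/-- The coefficient of `x₁^{-m-1} x₂^{-n-1}` in `[YW(u, x₁), YW(v, x₂)] w`. -/
def commutator (YW : V →ₗ[ℂ] VertexOperator ℂ W) (u v : V) (w : W) (m n : ℤ) : W :=
  VertexOperator.ncoeff (YW u) m (VertexOperator.ncoeff (YW v) n w)
    - VertexOperator.ncoeff (YW v) n (VertexOperator.ncoeff (YW u) m w)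

end FormalJacobi

/-- A vertex algebra structure on a complex vector space `V`. The truncation condition
`Y(u, x) v ∈ V((x))` is part of the type `VertexOperator ℂ V`. -/
@[ext]
structure VertexAlgebra (V : Type*) [AddCommGroup V] [Module ℂ V] where
  /-- the vacuum vector -/
  vac : V
  /-- the vertex operator map `v ↦ Y(v, x)` -/
  Y : V →ₗ[ℂ] VertexOperator ℂ V
  Y_vac : (Y vac).IsOne
  /-- `Y(v, x) 1 ∈ V[[x]]` -/
  creation_nonneg : ∀ (v : V) (n : ℤ), n < 0 → HVertexOperator.coeff (Y v) n vac = 0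
  /-- the constant term of `Y(v, x) 1` is `v` -/
  creation_zero : ∀ v : V, HVertexOperator.coeff (Y v) 0 vac = v
  jacobi : ∀ (u v w : V) (l m n : ℤ),
    FormalJacobi.termLeft Y u v w l m n - FormalJacobi.termRight Y u v w l m n
      = FormalJacobi.termIterate Y Y u v w l m n

namespace VertexAlgebra

variable {V W : Type*} [AddCommGroup V] [Module ℂ V] [AddCommGroup W] [Module ℂ W]

/-- A (two-sided) ideal of a vertex algebra: a subspace `I` with `u_n a ∈ I` and `a_n u ∈ I` for
all `a ∈ I`, `u ∈ V` and `n ∈ ℤ`. -/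
def IsIdeal (A : VertexAlgebra V) (I : Submodule ℂ V) : Prop :=
  ∀ a ∈ I, ∀ (u : V) (n : ℤ),
    VertexOperator.ncoeff (A.Y u) n a ∈ I ∧ VertexOperator.ncoeff (A.Y a) n u ∈ I

/-- The ideal generated by a set: the intersection of all ideals that contain it. -/
def idealSpan (A : VertexAlgebra V) (S : Set V) : Submodule ℂ V :=
  sInf {I : Submodule ℂ V | A.IsIdeal I ∧ S ⊆ I}

theorem subset_idealSpan (A : VertexAlgebra V) (S : Set V) : S ⊆ A.idealSpan S := by
  intro s hs
  simp only [idealSpan, SetLike.mem_coe, Submodule.mem_sInf]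
  exact fun I hI => hI.2 hs

theorem isIdeal_idealSpan (A : VertexAlgebra V) (S : Set V) : A.IsIdeal (A.idealSpan S) := by
  intro a ha u n
  simp only [idealSpan, Submodule.mem_sInf] at ha ⊢
  exact ⟨fun I hI => (hI.1 a (ha I hI) u n).1, fun I hI => (hI.1 a (ha I hI) u n).2⟩

/-- A homomorphism of vertex algebras. -/
structure IsHom (A : VertexAlgebra V) (B : VertexAlgebra W) (f : V →ₗ[ℂ] W) : Prop where
  map_vac : f A.vac = B.vac
  map_ncoeff : ∀ (u v : V) (n : ℤ),
    f (VertexOperator.ncoeff (A.Y u) n v) = VertexOperator.ncoeff (B.Y (f u)) n (f v)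

/-- A quasimodule `(W, Y_W)` for a vertex algebra. -/
structure IsQuasimodule (A : VertexAlgebra V) (YW : V →ₗ[ℂ] VertexOperator ℂ W) : Prop where
  vac : (YW A.vac).IsOne
  quasiJacobi : ∀ u v : V, ∃ p : MvPolynomial (Fin 2) ℂ, p ≠ 0 ∧
    FormalJacobi.HoldsWith A.Y YW p u v

end VertexAlgebra

/-- A `Γ`-vertex algebra structure on a complex vector space `V`. -/
@[ext]
structure GammaVertexAlgebra (Γ : Type*) [Group Γ] (V : Type*) [AddCommGroup V] [Module ℂ V]
    extends VertexAlgebra V where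
  R : Γ →* (V ≃ₗ[ℂ] V)
  φ : Γ →* ℂˣ
  R_vac : ∀ g : Γ, R g vac = vac
  /-- `R_g Y(v, x) R_g⁻¹ = Y(R_g v, φ(g)⁻¹ x)`, coefficient by coefficient. -/
  conj : ∀ (g : Γ) (v w : V) (n : ℤ),
    R g (HVertexOperator.coeff (Y v) n ((R g).symm w))
      = HVertexOperator.coeff ((Y (R g v)).rescale (φ g)⁻¹) n w

namespace GammaVertexAlgebra

variable {Γ : Type*} [Group Γ] {V W : Type*} [AddCommGroup V] [Module ℂ V]
  [AddCommGroup W] [Module ℂ W]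

/-- A quasimodule `(W, Y_W)` for a `Γ`-vertex algebra. -/
structure IsQuasimodule (A : GammaVertexAlgebra Γ V) (YW : V →ₗ[ℂ] VertexOperator ℂ W) : Prop
    extends A.toVertexAlgebra.IsQuasimodule YW where
  /-- `Y_W(R_g v, x) = Y_W(v, φ(g) x)` -/
  equivariant : ∀ (g : Γ) (v : V), YW (A.R g v) = (YW v).rescale (A.φ g)
  /-- `(x₁ - α₁ x₂) ⋯ (x₁ - α_k x₂) [Y_W(u, x₁), Y_W(v, x₂)] = 0` for some
  `α₁, …, α_k ∈ φ(Γ)` -/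
  locality : ∀ u v : V, ∃ α : List ℂˣ, (∀ a ∈ α, a ∈ A.φ.range) ∧
    ∀ (w : W) (m n : ℤ),
      FormalJacobi.polyMul
        (α.map fun a => MvPolynomial.X 0 - MvPolynomial.C (a : ℂ) * MvPolynomial.X 1).prod
        (FormalJacobi.commutator YW u v w) m n = 0

/-- The ideal `J` of `V` generated by the elements `R_h v - v`, `h ∈ ker φ`, `v ∈ V`. -/
def kerIdeal (A : GammaVertexAlgebra Γ V) : Submodule ℂ V :=
  A.toVertexAlgebra.idealSpan {x : V | ∃ h ∈ A.φ.ker, ∃ v : V, x = A.R h v - v}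

/-- `B` is the quotient vertex algebra structure on `V / J` (that is, the one for which the
projection is a homomorphism), and its `Γ / ker φ`-structure is the one induced by the
`Γ`-structure of `A`. -/
structure IsReduction (A : GammaVertexAlgebra Γ V)
    (B : GammaVertexAlgebra (Γ ⧸ A.φ.ker) (V ⧸ A.kerIdeal)) : Prop where
  isHom : A.toVertexAlgebra.IsHom B.toVertexAlgebra A.kerIdeal.mkQ
  R_mk : ∀ (g : Γ) (v : V),
    B.R (QuotientGroup.mk g) (A.kerIdeal.mkQ v) = A.kerIdeal.mkQ (A.R g v)
  φ_mk : ∀ g : Γ, B.φ (QuotientGroup.mk g) = A.φ g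

end GammaVertexAlgebra

end

noncomputable section

/-! The substance is that `ker Y_W` is an ideal for every quasimodule. If `Y_W(u, x) = 0` or `Y_W(v,
x) = 0`, both products in the quasi-Jacobi identity vanish, so `p` kills the iterate term. Taking
the coefficient of `x₁⁻¹` leaves `p(x₀ + x₂, x₂) Y_W(Y(u, x₀)v, x₂)w = 0`. This series lies in
`W((x₂))((x₀))`, where a nonzero polynomial acts injectively, so `Y_W(u_k v, x) = 0` for all `k`.
Equivariance puts the generators `R_h v - v` in `ker Y_W`, hence `J ⊆ ker Y_W` and `Y_W` factors
through `V/J`.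

`J` is `Γ`-stable because `R_g` maps ideals to ideals up to scalars on modes, and `ker φ` is normal.
The structure on `V/J` then descends mode by mode, and surjectivity of the projections gives
uniqueness. -/

/-! ### Polynomials acting on truncated series -/

/-- Lowest-term argument: `s l` sits at `x^{-l-1}`, so the greatest `l` with `s l ≠ 0` is the lowest
power, and it meets the lowest `T e` that does not kill the series. Coefficients `T e` may be
operators, so that the lemma serves first for `x₂` and then for `x₀`. -/
theorem eq_zero_of_sum_shift_eq_zero {M N : Type*} [Zero M] [AddCommMonoid N] (K : ℕ)
    (T : ℕ → M → N) (s : ℤ → M) (hs : ∃ L : ℤ, ∀ l, L ≤ l → s l = 0) (hT0 : ∀ e, T e 0 = 0)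
    (hT : ∀ e < K, (∀ l, T e (s l) = 0) ∨ ∀ l, T e (s l) = 0 → s l = 0)
    (hne : ∃ e < K, ∀ l, T e (s l) = 0 → s l = 0)
    (h : ∀ l : ℤ, ∑ e ∈ Finset.range K, T e (s (l + e)) = 0) (l : ℤ) : s l = 0 := by
  classical
  by_contra hl
  obtain ⟨L, hL⟩ := hs
  obtain ⟨l₁, hl₁, hmax⟩ := Int.exists_greatest_of_bdd (P := fun l => s l ≠ 0)
    ⟨L, fun z hz => le_of_not_gt fun hlt => hz (hL z hlt.le)⟩ ⟨l, hl⟩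
  obtain ⟨he₀K, he₀⟩ := Nat.find_spec hne
  have hmin := fun e => Nat.find_min (m := e) hne
  set e₀ := Nat.find hne
  have h1 := h (l₁ - e₀)
  rw [Finset.sum_eq_single_of_mem e₀ (Finset.mem_range.2 he₀K)] at h1
  · rw [sub_add_cancel] at h1
    exact hl₁ (he₀ _ h1)
  · intro e heK hne'
    rw [Finset.mem_range] at heK
    rcases lt_or_gt_of_ne hne' with hlt | hgt
    · rcases hT e heK with h2 | h2
      · exact h2 _
      · exact absurd ⟨heK, h2⟩ (hmin e hlt)
    · have : s (l₁ - e₀ + e) = 0 := by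
        by_contra h3
        have := hmax _ h3
        omega
      rw [this, hT0]

/-- Multiplication by the nonzero polynomial `p(x₀ + x₂, x₂)` is injective on `W((x₂))((x₀))`. -/
theorem eq_zero_of_sum_choose_smul_eq_zero {W : Type*} [AddCommGroup W] [Module ℂ W]
    (p : MvPolynomial (Fin 2) ℂ) (hp : p ≠ 0) (b : ℤ → ℤ → W)
    (hb : ∃ L : ℤ, ∀ l, L ≤ l → b l = 0) (hb' : ∀ l, ∃ N : ℤ, ∀ n, N ≤ n → b l n = 0)
    (K : ℕ) (hK : ∀ d ∈ p.support, d 0 < K)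
    (h : ∀ l n : ℤ, ∑ d ∈ p.support, ∑ i ∈ Finset.range K,
      (p.coeff d * ((d 0).choose i : ℂ)) • b (l + i) (n + d 0 + d 1 - i) = 0) : b = 0 := by
  classical
  -- `T i` multiplies by the coefficient of `x₀^i` in `p(x₀ + x₂, x₂)`, and `Q i e` is the
  -- coefficient of `x₀^i x₂^{e-i}`.
  let T : ℕ → (ℤ → W) → (ℤ → W) := fun i s n =>
    ∑ d ∈ p.support, (p.coeff d * ((d 0).choose i : ℂ)) • s (n + d 0 + d 1 - i)
  let Q : ℕ → ℕ → ℂ := fun i e =>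
    ∑ d ∈ p.support with d 0 + d 1 = e, p.coeff d * ((d 0).choose i : ℂ)
  obtain ⟨E, hE⟩ : ∃ E : ℕ, ∀ d ∈ p.support, d 0 + d 1 < E :=
    ⟨p.support.sup (fun d => d 0 + d 1) + 1, fun d hd =>
      Nat.lt_succ_of_le (Finset.le_sup (f := fun d : Fin 2 →₀ ℕ => d 0 + d 1) hd)⟩
  have hTQ : ∀ i s n, T i s n = ∑ e ∈ Finset.range E, Q i e • s (n + e - i) := by
    intro i s n
    simp only [T, Q]
    rw [← Finset.sum_fiberwise_of_maps_to (t := Finset.range E) (g := fun d => d 0 + d 1)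
      (fun d hd => Finset.mem_range.2 (hE d hd))]
    refine Finset.sum_congr rfl fun e _ => ?_
    rw [Finset.sum_smul]
    refine Finset.sum_congr rfl fun d hd => ?_
    rw [← (Finset.mem_filter.1 hd).2]
    push_cast
    rw [add_assoc]
  have hinj : ∀ i, (∃ e < E, Q i e ≠ 0) → ∀ l, T i (b l) = 0 → b l = 0 := by
    rintro i ⟨e, he, hQ⟩ l hl
    obtain ⟨N, hN⟩ := hb' l
    have key := eq_zero_of_sum_shift_eq_zero E (fun e (x : W) => Q i e • x)
      (fun n => b l (n - i)) ⟨N + i, fun n hn => hN _ (by omega)⟩ (fun e => smul_zero _)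
      (fun e _ => by
        by_cases h0 : Q i e = 0
        · exact Or.inl fun n => by simp [h0]
        · exact Or.inr fun n hn => (smul_eq_zero.1 hn).resolve_left h0)
      ⟨e, he, fun n hn => (smul_eq_zero.1 hn).resolve_left hQ⟩
      (fun n => by rw [← hTQ, hl]; rfl)
    funext n
    simpa using key (n + i)
  have hzero : ∀ i, (¬ ∃ e < E, Q i e ≠ 0) → ∀ l, T i (b l) = 0 := by
    intro i hi l
    push Not at hi
    funext n
    rw [hTQ]
    exact Finset.sum_eq_zero fun e he => by rw [hi e (Finset.mem_range.1 he), zero_smul]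
  -- Some `Q i e` is nonzero: in a homogeneous component of `p`, the monomial with the largest
  -- `x₁`-exponent is the only one contributing to that power of `x₀`.
  obtain ⟨d₁, hd₁⟩ := MvPolynomial.support_nonempty.2 hp
  obtain ⟨d₂, hd₂, hmax⟩ := Finset.exists_max_image
    {d ∈ p.support | d 0 + d 1 = d₁ 0 + d₁ 1} (fun d => d 0) ⟨d₁, by simp [-MvPolynomial.mem_support_iff, hd₁]⟩
  rw [Finset.mem_filter] at hd₂
  have hQ : Q (d₂ 0) (d₁ 0 + d₁ 1) = p.coeff d₂ := by
    simp only [Q]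
    rw [Finset.sum_eq_single_of_mem d₂ (Finset.mem_filter.2 hd₂)]
    · simp
    · intro d hd hne
      rw [Nat.choose_eq_zero_of_lt, Nat.cast_zero, mul_zero]
      refine lt_of_le_of_ne (hmax d hd) fun h0 => hne ?_
      have h1 := (Finset.mem_filter.1 hd).2
      ext j
      fin_cases j
      · exact h0
      · change d 1 = d₂ 1
        omega
  funext l
  refine eq_zero_of_sum_shift_eq_zero K T b hb (fun i => ?_) (fun i _ => ?_)
    ⟨d₂ 0, hK _ hd₂.1, hinj _ ⟨_, hE _ hd₁, ?_⟩⟩ (fun l => ?_) l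
  · funext n
    simp [T]
  · by_cases hi : ∃ e < E, Q i e ≠ 0
    · exact Or.inr (hinj i hi)
    · exact Or.inl (hzero i hi)
  · rw [hQ]
    exact MvPolynomial.mem_support_iff.1 hd₂.1
  · funext n
    rw [Finset.sum_apply]
    simp only [T]
    rw [Finset.sum_comm]
    exact h l n

/-! ### Modes of vertex operators -/

namespace VertexOperator

variable {V : Type*} [AddCommGroup V] [Module ℂ V]

theorem ext_ncoeff {A B : VertexOperator ℂ V} (h : ∀ n w, ncoeff A n w = ncoeff B n w) :
    A = B := by
  apply HVertexOperator.coeff_inj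
  funext n
  ext w
  simpa using h (-n - 1) w

theorem exists_ncoeff_eq_zero (A : VertexOperator ℂ V) (w : V) :
    ∃ N : ℤ, ∀ n, N ≤ n → ncoeff A n w = 0 :=
  -- The mode `n` is the coefficient of `x^{-n-1}`, which lies below the order as soon as `n ≥
  -- -order`.
  ⟨-HahnSeries.order ((HahnModule.of ℂ).symm (A w)), fun n hn =>
    ncoeff_eq_zero_of_lt_order A n w (by omega)⟩

theorem ncoeff_rescale (α : ℂˣ) (A : VertexOperator ℂ V) (n : ℤ) (w : V) :
    ncoeff (A.rescale α) n w = ((α ^ (-n - 1) : ℂˣ) : ℂ) • ncoeff A n w := rfl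

theorem rescale_one (A : VertexOperator ℂ V) : A.rescale 1 = A :=
  ext_ncoeff fun n w => by rw [ncoeff_rescale, one_zpow, Units.val_one, one_smul]

theorem isOne_iff (A : VertexOperator ℂ V) :
    A.IsOne ↔ ∀ n w, ncoeff A n w = if n = -1 then w else 0 := by
  constructor
  · intro h n w
    rw [ncoeff_apply, HVertexOperator.coeff_apply_apply, h w]
    simp only [Equiv.symm_apply_apply, HahnSeries.coeff_single]
    congr 1
    exact propext ⟨fun h => by omega, fun h => by omega⟩
  · intro h w
    apply (HahnModule.of ℂ).symm.injective
    ext n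
    have := h (-n - 1) w
    rw [← coeff_eq_ncoeff, HVertexOperator.coeff_apply_apply] at this
    rw [this]
    simp only [Equiv.symm_apply_apply, HahnSeries.coeff_single]
    congr 1
    exact propext ⟨fun h => by omega, fun h => by omega⟩

/-- The operator induced on `V / I` by a vertex operator that preserves `I`. -/
def quotient (I : Submodule ℂ V) (A : VertexOperator ℂ V)
    (h : ∀ n, ∀ a ∈ I, ncoeff A n a ∈ I) : VertexOperator ℂ (V ⧸ I) :=
  of_coeff (fun n => I.mapQ I (ncoeff A (-n - 1)) (h _)) (by
    intro x
    obtain ⟨w, rfl⟩ := I.mkQ_surjective x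
    obtain ⟨N, hN⟩ := exists_ncoeff_eq_zero A w
    refine ⟨-N, fun n hn => ?_⟩
    by_contra hlt
    apply hn
    simp [Submodule.mapQ_apply, hN (-n - 1) (by omega)])

@[simp]
theorem ncoeff_quotient (I : Submodule ℂ V) (A : VertexOperator ℂ V)
    (h : ∀ n, ∀ a ∈ I, ncoeff A n a ∈ I) (n : ℤ) (w : V) :
    ncoeff (A.quotient I h) n (I.mkQ w) = I.mkQ (ncoeff A n w) := by
  simp [quotient, Submodule.mapQ_apply]

end VertexOperator

open VertexOperator

/-! ### The terms of the Jacobi identity -/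

namespace FormalJacobi

variable {V V' W W' : Type*} [AddCommGroup V] [Module ℂ V] [AddCommGroup V'] [Module ℂ V']
  [AddCommGroup W] [Module ℂ W] [AddCommGroup W'] [Module ℂ W']

theorem finite_support_of_eventually_zero {M : Type*} [Zero M] (f : ℕ → M) (N : ℤ)
    (h : ∀ i : ℕ, N ≤ i → f i = 0) : (Function.support f).Finite :=
  (Set.finite_lt_nat N.toNat).subset fun i hi => by
    by_contra hlt
    simp only [Set.mem_ofPred_eq, not_lt] at hlt
    exact hi (h i (by omega))

variable (f : V →ₗ[ℂ] V') {Y : V →ₗ[ℂ] VertexOperator ℂ V} {Y' : V' →ₗ[ℂ] VertexOperator ℂ V'}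

/-- A linear map commutes with `∑ᶠ` here because truncation makes the support finite. -/
theorem map_termLeft (hf : ∀ (u v : V) (n : ℤ), f (ncoeff (Y u) n v) = ncoeff (Y' (f u)) n (f v))
    (u v w : V) (l m n : ℤ) :
    f (termLeft Y u v w l m n) = termLeft Y' (f u) (f v) (f w) l m n := by
  obtain ⟨N, hN⟩ := exists_ncoeff_eq_zero (Y v) w
  unfold termLeft
  rw [map_finsum f (finite_support_of_eventually_zero _ (N - n) fun i hi => by
    rw [hN _ (by omega), map_zero, smul_zero])]
  simp only [map_smul, hf]

theorem map_termRight (hf : ∀ (u v : V) (n : ℤ), f (ncoeff (Y u) n v) = ncoeff (Y' (f u)) n (f v))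
    (u v w : V) (l m n : ℤ) :
    f (termRight Y u v w l m n) = termRight Y' (f u) (f v) (f w) l m n := by
  obtain ⟨N, hN⟩ := exists_ncoeff_eq_zero (Y u) w
  unfold termRight
  rw [map_finsum f (finite_support_of_eventually_zero _ (N - m) fun i hi => by
    rw [hN _ (by omega), map_zero, smul_zero])]
  simp only [map_smul, hf]

theorem map_termIterate
    (hf : ∀ (u v : V) (n : ℤ), f (ncoeff (Y u) n v) = ncoeff (Y' (f u)) n (f v))
    (u v w : V) (l m n : ℤ) :
    f (termIterate Y Y u v w l m n) = termIterate Y' Y' (f u) (f v) (f w) l m n := by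
  obtain ⟨N, hN⟩ := exists_ncoeff_eq_zero (Y u) v
  unfold termIterate
  rw [map_finsum f (finite_support_of_eventually_zero _ (N - l) fun i hi => by
    rw [hN _ (by omega), map_zero, map_zero, Pi.zero_apply, LinearMap.zero_apply, smul_zero])]
  simp only [map_smul, hf]

/-- The coefficient of `x₁⁻¹` in the iterate term of the Jacobi identity. -/
theorem polyMul_termIterate_zero (Y : V →ₗ[ℂ] VertexOperator ℂ V)
    (YW : V →ₗ[ℂ] VertexOperator ℂ W) (p : MvPolynomial (Fin 2) ℂ) (K : ℕ)
    (hK : ∀ d ∈ p.support, d 0 < K) (u v : V) (w : W) (l n : ℤ) :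
    polyMul p (termIterate Y YW u v w l) 0 n =
      ∑ d ∈ p.support, ∑ i ∈ Finset.range K, (p.coeff d * ((d 0).choose i : ℂ)) •
        ncoeff (YW (ncoeff (Y u) (l + i) v)) (n + d 0 + d 1 - i) w := by
  unfold polyMul termIterate
  refine Finset.sum_congr rfl fun d hd => ?_
  rw [finsum_eq_sum_of_support_subset (s := Finset.range K), Finset.smul_sum]
  · refine Finset.sum_congr rfl fun i _ => ?_
    rw [zero_add, Ring.choose_natCast, Int.cast_natCast, smul_smul,
      show (d 0 : ℤ) + (n + d 1) - i = n + d 0 + d 1 - i by ring]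
  · intro i hi
    rw [Finset.coe_range, Set.mem_Iio]
    by_contra hlt
    apply hi
    -- At `m = 0` the upper index of the binomial is the natural number `d 0`, so terms with `i ≥ K`
    -- vanish.
    have := hK d hd
    simp only
    rw [zero_add, Ring.choose_natCast, Nat.choose_eq_zero_of_lt (by omega)]
    simp

theorem eq_zero_of_polyMul_termIterate (Y : V →ₗ[ℂ] VertexOperator ℂ V)
    (YW : V →ₗ[ℂ] VertexOperator ℂ W) {p : MvPolynomial (Fin 2) ℂ} (hp : p ≠ 0) (u v : V)
    (h : ∀ (w : W) (l m n : ℤ), polyMul p (termIterate Y YW u v w l) m n = 0) (k : ℤ) :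
    YW (ncoeff (Y u) k v) = 0 := by
  apply ext_ncoeff
  intro n w
  have hK : ∀ d ∈ p.support, d 0 < p.support.sup (fun d => d 0) + 1 := fun d hd =>
    Nat.lt_succ_of_le (Finset.le_sup (f := fun d : Fin 2 →₀ ℕ => d 0) hd)
  -- With `w` fixed, truncation of `Y(u, x₀)v` bounds `l` uniformly in `n`; truncation of `Y_W` then
  -- bounds `n` for each `l`.
  have := eq_zero_of_sum_choose_smul_eq_zero p hp
    (fun l n => ncoeff (YW (ncoeff (Y u) l v)) n w) (by
      obtain ⟨L, hL⟩ := exists_ncoeff_eq_zero (Y u) v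
      exact ⟨L, fun l hl => by funext n; rw [hL l hl]; simp⟩)
    (fun l => exists_ncoeff_eq_zero _ w) _ hK
    (fun l n => by rw [← polyMul_termIterate_zero Y YW p _ hK, h])
  rw [map_zero]
  exact congrFun (congrFun this k) n

theorem polyMul_zero (p : MvPolynomial (Fin 2) ℂ) (m n : ℤ) :
    polyMul p (fun _ _ => (0 : W)) m n = 0 := by
  simp [polyMul]

theorem HoldsWith.iterate_eq_zero {Y : V →ₗ[ℂ] VertexOperator ℂ V}
    {YW : V →ₗ[ℂ] VertexOperator ℂ W} {p : MvPolynomial (Fin 2) ℂ} (hp : p ≠ 0) {u v : V}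
    (h : HoldsWith Y YW p u v) (huv : YW u = 0 ∨ YW v = 0) (k : ℤ) :
    YW (ncoeff (Y u) k v) = 0 := by
  refine eq_zero_of_polyMul_termIterate Y YW hp u v (fun w l m n => ?_) k
  rw [← h w l m n]
  have hL : termLeft YW u v w l = fun _ _ => 0 := by
    funext m n
    rcases huv with h0 | h0 <;> simp [termLeft, h0]
  have hR : termRight YW u v w l = fun _ _ => 0 := by
    funext m n
    rcases huv with h0 | h0 <;> simp [termRight, h0]
  rw [hL, hR, polyMul_zero, sub_zero]

end FormalJacobi

/-! ### Ideals, quotients and homomorphisms of vertex algebras -/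

namespace VertexAlgebra

variable {V W : Type*} [AddCommGroup V] [Module ℂ V] [AddCommGroup W] [Module ℂ W]

theorem idealSpan_le (A : VertexAlgebra V) {S : Set V} {I : Submodule ℂ V} (hI : A.IsIdeal I)
    (hS : S ⊆ I) : A.idealSpan S ≤ I :=
  sInf_le ⟨hI, hS⟩

/-- The two sides of the ideal condition come from the quasi-Jacobi identities for `(u, a)` and `(a,
u)`, each with its own polynomial. -/
theorem IsQuasimodule.isIdeal_ker {A : VertexAlgebra V} {YW : V →ₗ[ℂ] VertexOperator ℂ W}
    (h : A.IsQuasimodule YW) : A.IsIdeal (LinearMap.ker YW) := by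
  intro a ha u n
  rw [LinearMap.mem_ker] at ha
  obtain ⟨p, hp, hJ⟩ := h.quasiJacobi u a
  obtain ⟨q, hq, hJ'⟩ := h.quasiJacobi a u
  exact ⟨hJ.iterate_eq_zero hp (Or.inr ha) n, hJ'.iterate_eq_zero hq (Or.inl ha) n⟩

/-- The vertex operator map induced on the quotient by an ideal. -/
def quotientY (A : VertexAlgebra V) (I : Submodule ℂ V) (hI : A.IsIdeal I) :
    (V ⧸ I) →ₗ[ℂ] VertexOperator ℂ (V ⧸ I) :=
  I.liftQ
    { toFun := fun v => (A.Y v).quotient I fun n a ha => (hI a ha v n).1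
      map_add' := fun u v => ext_ncoeff fun n x => by
        obtain ⟨w, rfl⟩ := I.mkQ_surjective x
        simp only [map_add, Pi.add_apply, LinearMap.add_apply, ncoeff_quotient]
      map_smul' := fun c v => ext_ncoeff fun n x => by
        obtain ⟨w, rfl⟩ := I.mkQ_surjective x
        simp only [map_smul, Pi.smul_apply, LinearMap.smul_apply, ncoeff_quotient,
          RingHom.id_apply] }
    (fun a ha => by
      refine ext_ncoeff fun n x => ?_
      obtain ⟨w, rfl⟩ := I.mkQ_surjective x
      simp only [LinearMap.coe_mk, AddHom.coe_mk, ncoeff_quotient]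
      simpa using (hI a ha w n).2)

theorem ncoeff_quotientY (A : VertexAlgebra V) (I : Submodule ℂ V) (hI : A.IsIdeal I) (u v : V)
    (n : ℤ) :
    ncoeff (A.quotientY I hI (I.mkQ u)) n (I.mkQ v) = I.mkQ (ncoeff (A.Y u) n v) :=
  ncoeff_quotient I (A.Y u) (fun n a ha => (hI a ha u n).1) n v

/-- The quotient of a vertex algebra by an ideal. -/
def quotient (A : VertexAlgebra V) (I : Submodule ℂ V) (hI : A.IsIdeal I) :
    VertexAlgebra (V ⧸ I) where
  vac := I.mkQ A.vac
  Y := A.quotientY I hI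
  Y_vac := by
    rw [isOne_iff]
    intro n x
    obtain ⟨w, rfl⟩ := I.mkQ_surjective x
    rw [ncoeff_quotientY, (isOne_iff _).1 A.Y_vac n w]
    split_ifs <;> simp
  creation_nonneg := by
    intro x n hn
    obtain ⟨v, rfl⟩ := I.mkQ_surjective x
    have := A.creation_nonneg v n hn
    rw [coeff_eq_ncoeff] at this ⊢
    rw [ncoeff_quotientY, this, map_zero]
  creation_zero := by
    intro x
    obtain ⟨v, rfl⟩ := I.mkQ_surjective x
    have := A.creation_zero v
    rw [coeff_eq_ncoeff] at this ⊢
    rw [ncoeff_quotientY, this]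
  jacobi := by
    intro x y z l m n
    obtain ⟨u, rfl⟩ := I.mkQ_surjective x
    obtain ⟨v, rfl⟩ := I.mkQ_surjective y
    obtain ⟨w, rfl⟩ := I.mkQ_surjective z
    have h : ∀ (u v : V) (n : ℤ), I.mkQ (ncoeff (A.Y u) n v)
        = ncoeff (A.quotientY I hI (I.mkQ u)) n (I.mkQ v) :=
      fun u v n => (A.ncoeff_quotientY I hI u v n).symm
    rw [← FormalJacobi.map_termLeft I.mkQ h, ← FormalJacobi.map_termRight I.mkQ h,
      ← FormalJacobi.map_termIterate I.mkQ h, ← map_sub, A.jacobi]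

theorem isHom_quotient (A : VertexAlgebra V) (I : Submodule ℂ V) (hI : A.IsIdeal I) :
    A.IsHom (A.quotient I hI) I.mkQ where
  map_vac := rfl
  map_ncoeff u v n := (A.ncoeff_quotientY I hI u v n).symm

/-- The vertex algebra structure on the target of a surjective homomorphism is determined. -/
theorem IsHom.unique {A : VertexAlgebra V} {B C : VertexAlgebra W} {f : V →ₗ[ℂ] W}
    (hf : Function.Surjective f) (hB : A.IsHom B f) (hC : A.IsHom C f) : B = C := by
  apply VertexAlgebra.ext
  · rw [← hB.map_vac, hC.map_vac]
  · ext1 x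
    refine ext_ncoeff fun n y => ?_
    obtain ⟨u, rfl⟩ := hf x
    obtain ⟨v, rfl⟩ := hf y
    rw [← hB.map_ncoeff, hC.map_ncoeff]

/-- Quasimodule actions that agree along a surjective homomorphism satisfy the same identities. -/
theorem IsHom.holdsWith {U : Type*} [AddCommGroup U] [Module ℂ U] {A : VertexAlgebra V}
    {B : VertexAlgebra W} {f : V →ₗ[ℂ] W} (hf : A.IsHom B f) {YU : V →ₗ[ℂ] VertexOperator ℂ U}
    {YU' : W →ₗ[ℂ] VertexOperator ℂ U} (h : ∀ v, YU' (f v) = YU v)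
    {p : MvPolynomial (Fin 2) ℂ} {u v : V} (hJ : FormalJacobi.HoldsWith A.Y YU p u v) :
    FormalJacobi.HoldsWith B.Y YU' p (f u) (f v) := by
  intro w l m n
  have hL : FormalJacobi.termLeft YU' (f u) (f v) w l = FormalJacobi.termLeft YU u v w l := by
    funext m n
    simp only [FormalJacobi.termLeft, h]
  have hR : FormalJacobi.termRight YU' (f u) (f v) w l = FormalJacobi.termRight YU u v w l := by
    funext m n
    simp only [FormalJacobi.termRight, h]
  have hI : FormalJacobi.termIterate B.Y YU' (f u) (f v) w l
      = FormalJacobi.termIterate A.Y YU u v w l := by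
    funext m n
    simp only [FormalJacobi.termIterate, ← hf.map_ncoeff, h]
  rw [hL, hR, hI, hJ]

end VertexAlgebra

/-! ### The reduction `V/J` -/

namespace GammaVertexAlgebra

variable {Γ : Type*} [Group Γ] {V W : Type*} [AddCommGroup V] [Module ℂ V]
  [AddCommGroup W] [Module ℂ W] (A : GammaVertexAlgebra Γ V)

theorem R_ncoeff (g : Γ) (v w : V) (n : ℤ) :
    A.R g (ncoeff (A.Y v) n w) =
      (((A.φ g)⁻¹ ^ (-n - 1) : ℂˣ) : ℂ) • ncoeff (A.Y (A.R g v)) n (A.R g w) := by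
  have := A.conj g v (A.R g w) (-n - 1)
  rwa [LinearEquiv.symm_apply_apply] at this

theorem isIdeal_kerIdeal : A.IsIdeal A.kerIdeal :=
  A.isIdeal_idealSpan _

theorem R_sub_mem_kerIdeal {h : Γ} (hh : h ∈ A.φ.ker) (v : V) : A.R h v - v ∈ A.kerIdeal :=
  A.subset_idealSpan _ ⟨h, hh, v, rfl⟩

theorem mkQ_R {h : Γ} (hh : h ∈ A.φ.ker) (v : V) :
    A.kerIdeal.mkQ (A.R h v) = A.kerIdeal.mkQ v :=
  (Submodule.Quotient.eq _).2 (A.R_sub_mem_kerIdeal hh v)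

/-- The preimage of `J` under `R_g` is an ideal, since `R_g` respects modes up to a scalar. It
contains the generators because conjugation by `g` preserves `ker φ`. -/
theorem kerIdeal_le_comap_R (g : Γ) :
    A.kerIdeal ≤ A.kerIdeal.comap (A.R g : V →ₗ[ℂ] V) := by
  refine A.idealSpan_le (fun a ha u n => ?_) ?_
  · rw [Submodule.mem_comap] at ha
    have h := A.isIdeal_kerIdeal (A.R g a) ha (A.R g u) n
    simp only [Submodule.mem_comap, LinearEquiv.coe_coe, R_ncoeff]
    exact ⟨Submodule.smul_mem _ _ h.1, Submodule.smul_mem _ _ h.2⟩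
  · rintro _ ⟨h, hh, v, rfl⟩
    have key : A.R g (A.R h v - v) = A.R (g * h * g⁻¹) (A.R g v) - A.R g v := by
      rw [map_sub, ← LinearEquiv.mul_apply, ← LinearEquiv.mul_apply, ← map_mul, ← map_mul,
        inv_mul_cancel_right]
    simp only [Submodule.comap_coe, Set.mem_preimage, LinearEquiv.coe_coe, SetLike.mem_coe, key]
    exact A.R_sub_mem_kerIdeal (A.φ.normal_ker.conj_mem h hh g) _

/-- The action of `Γ` on `V / J`. -/
def quotientR : Γ →* ((V ⧸ A.kerIdeal) ≃ₗ[ℂ] (V ⧸ A.kerIdeal)) :=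
  MonoidHom.mk'
    (fun g => LinearEquiv.ofLinearMap
      (A.kerIdeal.mapQ A.kerIdeal (A.R g : V →ₗ[ℂ] V) (A.kerIdeal_le_comap_R g))
      (A.kerIdeal.mapQ A.kerIdeal (A.R g⁻¹ : V →ₗ[ℂ] V) (A.kerIdeal_le_comap_R g⁻¹))
      (by
        ext v
        simp [Submodule.mapQ_apply, ← LinearEquiv.mul_apply, ← map_mul, -map_inv])
      (by
        ext v
        simp [Submodule.mapQ_apply, ← LinearEquiv.mul_apply, ← map_mul, -map_inv]))
    (by
      intro g h
      ext x
      obtain ⟨v, rfl⟩ := A.kerIdeal.mkQ_surjective x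
      simp [Submodule.mapQ_apply])

theorem quotientR_mkQ (g : Γ) (v : V) :
    A.quotientR g (A.kerIdeal.mkQ v) = A.kerIdeal.mkQ (A.R g v) := rfl

/-- The `Γ / ker φ`-vertex algebra structure induced on `V / J`. -/
def reduction : GammaVertexAlgebra (Γ ⧸ A.φ.ker) (V ⧸ A.kerIdeal) where
  toVertexAlgebra := A.toVertexAlgebra.quotient A.kerIdeal A.isIdeal_kerIdeal
  R := QuotientGroup.lift A.φ.ker A.quotientR (fun h hh => by
    ext x
    obtain ⟨v, rfl⟩ := A.kerIdeal.mkQ_surjective x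
    rw [quotientR_mkQ, A.mkQ_R hh]
    rfl)
  φ := QuotientGroup.kerLift A.φ
  R_vac := by
    rintro ⟨g⟩
    change A.kerIdeal.mkQ (A.R g A.vac) = A.kerIdeal.mkQ A.vac
    rw [A.R_vac]
  conj := by
    rintro ⟨g⟩ x y n
    obtain ⟨v, rfl⟩ := A.kerIdeal.mkQ_surjective x
    obtain ⟨y, rfl⟩ := A.kerIdeal.mkQ_surjective y
    -- Writing the argument as `R_g w` makes the inverse in the conjugation formula cancel.
    obtain ⟨w, rfl⟩ := (A.R g).surjective y
    rw [coeff_eq_ncoeff, coeff_eq_ncoeff, ncoeff_rescale]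
    change A.quotientR g (ncoeff (A.quotientY _ A.isIdeal_kerIdeal (A.kerIdeal.mkQ v)) (-n - 1)
        ((A.quotientR g).symm (A.quotientR g (A.kerIdeal.mkQ w))))
      = (((A.φ g)⁻¹ ^ (-(-n - 1) - 1) : ℂˣ) : ℂ) •
        ncoeff (A.quotientY _ A.isIdeal_kerIdeal (A.kerIdeal.mkQ (A.R g v))) (-n - 1)
          (A.kerIdeal.mkQ (A.R g w))
    rw [LinearEquiv.symm_apply_apply, VertexAlgebra.ncoeff_quotientY,
      VertexAlgebra.ncoeff_quotientY, quotientR_mkQ, R_ncoeff, map_smul]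

theorem isReduction_reduction : A.IsReduction A.reduction where
  isHom := A.toVertexAlgebra.isHom_quotient _ A.isIdeal_kerIdeal
  R_mk _ _ := rfl
  φ_mk _ := rfl

/-! ### Uniqueness, and descent of quasimodules -/

variable {A}

theorem IsReduction.unique {B C : GammaVertexAlgebra (Γ ⧸ A.φ.ker) (V ⧸ A.kerIdeal)}
    (hB : A.IsReduction B) (hC : A.IsReduction C) : B = C := by
  have h := hB.isHom.unique A.kerIdeal.mkQ_surjective hC.isHom
  apply GammaVertexAlgebra.ext
  · exact congrArg VertexAlgebra.vac h
  · exact congrArg VertexAlgebra.Y h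
  · refine MonoidHom.ext fun q => LinearEquiv.ext fun x => ?_
    obtain ⟨g, rfl⟩ := QuotientGroup.mk_surjective q
    obtain ⟨v, rfl⟩ := A.kerIdeal.mkQ_surjective x
    rw [hB.R_mk, hC.R_mk]
  · refine MonoidHom.ext fun q => ?_
    obtain ⟨g, rfl⟩ := QuotientGroup.mk_surjective q
    rw [hB.φ_mk, hC.φ_mk]

theorem IsReduction.injective_φ {B : GammaVertexAlgebra (Γ ⧸ A.φ.ker) (V ⧸ A.kerIdeal)}
    (hB : A.IsReduction B) : Function.Injective B.φ := by
  rw [injective_iff_map_eq_one]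
  intro q hq
  obtain ⟨g, rfl⟩ := QuotientGroup.mk_surjective q
  rw [hB.φ_mk] at hq
  exact (QuotientGroup.eq_one_iff g).2 hq

/-- For `φ(h) = 1`, equivariance reads `Y_W(R_h v, x) = Y_W(v, x)`, so the ideal `ker Y_W` contains
the generators of `J`. -/
theorem IsQuasimodule.kerIdeal_le_ker {YW : V →ₗ[ℂ] VertexOperator ℂ W}
    (h : A.IsQuasimodule YW) : A.kerIdeal ≤ LinearMap.ker YW := by
  refine A.idealSpan_le h.isIdeal_ker ?_
  rintro _ ⟨g, hg, v, rfl⟩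
  rw [SetLike.mem_coe, LinearMap.mem_ker, map_sub, h.equivariant, (MonoidHom.mem_ker).1 hg,
    rescale_one, sub_self]

theorem IsReduction.isQuasimodule_of_comp
    {B : GammaVertexAlgebra (Γ ⧸ A.φ.ker) (V ⧸ A.kerIdeal)} (hB : A.IsReduction B)
    {YW : V →ₗ[ℂ] VertexOperator ℂ W} (h : A.IsQuasimodule YW)
    {YW' : (V ⧸ A.kerIdeal) →ₗ[ℂ] VertexOperator ℂ W}
    (hYW : ∀ v, YW' (A.kerIdeal.mkQ v) = YW v) : B.IsQuasimodule YW' where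
  vac := by
    rw [← hB.isHom.map_vac, hYW]
    exact h.vac
  quasiJacobi x y := by
    obtain ⟨u, rfl⟩ := A.kerIdeal.mkQ_surjective x
    obtain ⟨v, rfl⟩ := A.kerIdeal.mkQ_surjective y
    obtain ⟨p, hp, hJ⟩ := h.quasiJacobi u v
    exact ⟨p, hp, hB.isHom.holdsWith hYW hJ⟩
  equivariant q x := by
    obtain ⟨g, rfl⟩ := QuotientGroup.mk_surjective q
    obtain ⟨v, rfl⟩ := A.kerIdeal.mkQ_surjective x
    rw [hB.R_mk, hYW, hYW, hB.φ_mk, h.equivariant]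
  locality x y := by
    obtain ⟨u, rfl⟩ := A.kerIdeal.mkQ_surjective x
    obtain ⟨v, rfl⟩ := A.kerIdeal.mkQ_surjective y
    obtain ⟨α, hα, hloc⟩ := h.locality u v
    refine ⟨α, fun a ha => ?_, fun w m n => ?_⟩
    · obtain ⟨g, rfl⟩ := hα a ha
      exact ⟨QuotientGroup.mk g, hB.φ_mk g⟩
    · have hc : FormalJacobi.commutator YW' (A.kerIdeal.mkQ u) (A.kerIdeal.mkQ v) w
          = FormalJacobi.commutator YW u v w := by
        funext m n
        simp only [FormalJacobi.commutator, hYW]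
      rw [hc]
      exact hloc w m n

end GammaVertexAlgebra

end

theorem proposition2p12 {Γ : Type*} [Group Γ] {V : Type*} [AddCommGroup V] [Module ℂ V]
    (A : GammaVertexAlgebra Γ V) :
    -- the action of `Γ` descends to `V / J`, and `ker φ` acts trivially there
    (∀ g : Γ, ∀ a ∈ A.kerIdeal, A.R g a ∈ A.kerIdeal) ∧
    (∀ h ∈ A.φ.ker, ∀ v : V, A.kerIdeal.mkQ (A.R h v) = A.kerIdeal.mkQ v) ∧
    -- `V / J` carries a unique induced structure of a `Γ / ker φ`-vertex algebra
    (∃! B : GammaVertexAlgebra (Γ ⧸ A.φ.ker) (V ⧸ A.kerIdeal), A.IsReduction B) ∧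
    ∀ B : GammaVertexAlgebra (Γ ⧸ A.φ.ker) (V ⧸ A.kerIdeal), A.IsReduction B →
      Function.Injective B.φ ∧
      -- quasimodules for `V` vanish on `J` and descend to `V / J`
      ∀ (W : Type*) [AddCommGroup W] [Module ℂ W] (YW : V →ₗ[ℂ] VertexOperator ℂ W),
        A.IsQuasimodule YW →
          (∀ a ∈ A.kerIdeal, YW a = 0) ∧
          ∃! YW' : (V ⧸ A.kerIdeal) →ₗ[ℂ] VertexOperator ℂ W,
            B.IsQuasimodule YW' ∧ ∀ v : V, YW' (A.kerIdeal.mkQ v) = YW v := by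
  refine ⟨fun g a ha => A.kerIdeal_le_comap_R g ha, fun h hh v => A.mkQ_R hh v,
    ⟨A.reduction, A.isReduction_reduction, fun B hB => hB.unique A.isReduction_reduction⟩,
    fun B hB => ⟨hB.injective_φ, fun W _ _ YW h => ⟨fun a ha => h.kerIdeal_le_ker ha,
      A.kerIdeal.liftQ YW h.kerIdeal_le_ker,
      ⟨hB.isQuasimodule_of_comp h fun v => rfl, fun v => rfl⟩, ?_⟩⟩⟩
  rintro Y' ⟨-, hY'⟩
  refine LinearMap.ext fun x => ?_
  obtain ⟨v, rfl⟩ := A.kerIdeal.mkQ_surjective x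
  exact hY' v
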